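/- Let $U_0=[0,1]^2$ with the taxicab metric $d((x,y),(x_1,y_1))=|x-x_1|+|y-y_1|$, and let $M_0$ be its boundary. A \emph{square metric space} is a metric space $X$ with all distances at most $2$, together with an injective map $S_X\colon M_0\to X$ such that $d_X(S_X(i,r),S_X(i,s))=d_X(S_X(r,i),S_X(s,i))=|r-s|$ for $i\in\{0,1\}$ and $r,s\in[0,1]$, and $d_X(S_X(r,s),S_X(t,u))\ge |r-t|+|s-u|$ for all $(r,s),(t,u)\in M_0$. Let $\mathsf{SquaMS}$ be the category of square metric spaces, whose morphisms $f\colon X\to Y$ are the short maps ($d_Y(f(x),f(y))\le d_X(x,y)$) with $f\circ S_X=S_Y$. Let $N=\{0,1,2\}^2$ (cells of the $3\times3$ grid, given as (column, row)) and $M=N\setminus\{(1,1)\}$. For $P\in\{M,N\}$ let $P\otimes X$ be the quotient of $P\times X$ by the equivalence relation generated by $$((i,j),S_X(1,r))\sim((i+1,j),S_X(0,r)),\qquad ((i,j),S_X(r,1))\sim((i,j+1),S_X(r,0))$$ for $r\in[0,1]$ and all pairs of adjacent cells in $P$; write $m\otimes x$ for the class of $(m,x)$. The distance of two points of $P\otimes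 X$ is the infimum of the scores of finite paths in $P\times X$ between representatives, where a step between two identified points scores $0$, any other step from $(m,x)$ to $(m,y)$ scores $\frac13 d_X(x,y)$, and any other step between different copies scores $2$. With this metric and the boundary map $$S_{M\otimes X}(r,s)=(i,j)\otimes S_X(3r-i,3s-j)\quad\text{whenever } (i,j)\in M \text{ and } (3r-i,3s-j)\in M_0,$$ $M\otimes X$ is a square metric space, and $M\otimes-$, with $(M\otimes f)(m\otimes x)=m\otimes f(x)$, is an endofunctor of $\mathsf{SquaMS}$. Let $\alpha_N\colon N\otimes U_0\to U_0$ be the map $(i,j)\otimes z\mapsto(\frac i3,\frac j3)+\frac13 z$. The Sierpinski carpet $\mathbb S$ is the unique non-empty compact subset of $U_0$ with $\mathbb S=\bigcup_{(i,j)\in M}\big((\frac i3,\frac j3)+\frac13\mathbb S\big)$; with the taxicab metric and the inclusion $M_0\subseteq\mathbb S$ it is a square metric space. Let $\tau\colon M\otimes\mathbb S\to\mathbb S$, $(i,j)\otimes s\mapsto(\frac i3,\frac j3)+\frac13 s$, be the restriction of $\alpha_N$; it is a morphism of $\mathsf{SquaMS}$. \textbf{Theorem.} $(\mathbb S,\tau)$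 is a corecursive algebra for $M\otimes-\colon\mathsf{SquaMS}\to\mathsf{SquaMS}$. That is, for every coalgebra $\beta\colon B\to M\otimes B$ in $\mathsf{SquaMS}$ there is exactly one morphism $\beta^*\colon B\to\mathbb S$ of $\mathsf{SquaMS}$ with $\beta^*=\tau\circ(M\otimes\beta^*)\circ\beta$. Moreover, $\tau$ is a bijection, but its inverse $\tau^{-1}\colon\mathbb S\to M\otimes\mathbb S$ is not a short map. -/

import Mathlib

universe u

namespace Sierpinski

open CategoryTheory

/-! ### The unit square with the taxicab metric -/

/-- The plane with the taxicab metric, see `dist_plane`. -/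
abbrev Plane : Type := WithLp 1 (ℝ × ℝ)

theorem dist_plane (p q : Plane) : dist p q = |p.fst - q.fst| + |p.snd - q.snd| := by
  rw [WithLp.prod_dist_eq_add (by norm_num)]
  simp [Real.dist_eq]

theorem plane_ext {p q : Plane} (h1 : p.fst = q.fst) (h2 : p.snd = q.snd) : p = q :=
  WithLp.ofLp_injective 1 (Prod.ext h1 h2)

/-- The unit square `U₀ = [0,1]²`. -/
def unitSquare : Set Plane :=
  {p | 0 ≤ p.fst ∧ p.fst ≤ 1 ∧ 0 ≤ p.snd ∧ p.snd ≤ 1}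

/-- The boundary `M₀` of the unit square. -/
def boundary : Set Plane :=
  {p | p ∈ unitSquare ∧ (p.fst = 0 ∨ p.fst = 1 ∨ p.snd = 0 ∨ p.snd = 1)}

/-! ### The category of square metric spaces -/

/-- A square metric space: a metric space with all distances at most `2`, with an injective map `S`
from the boundary of the unit square. Along each of the four sides distances agree with those
of the unit interval; in general they are at least the taxicab distance. -/
structure SquaMS : Type (u + 1) where
  carrier : Type u
  [metric : MetricSpace carrier]
  S : boundary → carrier
  S_injective : Function.Injective S
  dist_le_two : ∀ x y : carrier, dist x y ≤ 2
  sq1_vertical : ∀ p q : boundary, p.1.fst = q.1.fst → (p.1.fst = 0 ∨ p.1.fst = 1) →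
    dist (S p) (S q) = |q.1.snd - p.1.snd|
  sq1_horizontal : ∀ p q : boundary, p.1.snd = q.1.snd → (p.1.snd = 0 ∨ p.1.snd = 1) →
    dist (S p) (S q) = |q.1.fst - p.1.fst|
  sq2 : ∀ p q : boundary, |p.1.fst - q.1.fst| + |p.1.snd - q.1.snd| ≤ dist (S p) (S q)

instance : CoeSort SquaMS.{u} (Type u) := ⟨SquaMS.carrier⟩

attribute [instance] SquaMS.metric

/-- Morphisms of square metric spaces: short maps that preserve `S`. -/
@[ext]
structure SquaMS.Hom (X Y : SquaMS.{u}) : Type u where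
  toFun : X → Y
  short : ∀ x y : X, dist (toFun x) (toFun y) ≤ dist x y
  map_S : ∀ p : boundary, toFun (X.S p) = Y.S p

instance : Category SquaMS.{u} where
  Hom := SquaMS.Hom
  id X := ⟨fun x => x, fun _ _ => le_rfl, fun _ => rfl⟩
  comp f g := ⟨fun x => g.toFun (f.toFun x),
    fun x y => (g.short _ _).trans (f.short x y),
    fun p => by rw [f.map_S, g.map_S]⟩

/-! ### Gluing nine (or eight) copies of a square metric space -/

/-- Positions (column, row) in the `3 × 3` grid. -/
abbrev Cell : Type := Fin 3 × Fin 3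

/-- The set `M` of all cells but the central one. -/
def M : Set Cell := {m | m ≠ (1, 1)}

/-- The set `N` of all nine cells. -/
def N : Set Cell := Set.univ

/-- The generating gluing relation: the right side of a cell is glued to the left side of the
cell on its right, and the top side of a cell is glued to the bottom side of the cell above it. -/
def Glued (m n : Cell) (p q : boundary) : Prop :=
  (n.1.val = m.1.val + 1 ∧ n.2 = m.2 ∧ p.1.fst = 1 ∧ q.1.fst = 0 ∧ p.1.snd = q.1.snd) ∨
  (n.1 = m.1 ∧ n.2.val = m.2.val + 1 ∧ p.1.snd = 1 ∧ q.1.snd = 0 ∧ p.1.fst = q.1.fst)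

/-- The relation `Glued`, transported to `P × X` along `S`. -/
def GlueRel (P : Set Cell) (X : SquaMS.{u}) (a b : P × X) : Prop :=
  ∃ p q : boundary, a.2 = X.S p ∧ b.2 = X.S q ∧ Glued a.1.1 b.1.1 p q

/-- The underlying set of `P ⊗ X`: the quotient of `P × X` by the equivalence relation generated by
`GlueRel`. -/
def Tensor (P : Set Cell) (X : SquaMS.{u}) : Type u := Quot (GlueRel P X)

/-- The element `m ⊗ x`, for a pair `(m, x)`. -/
def Tensor.mk {P : Set Cell} {X : SquaMS.{u}} (a : P × X) : Tensor P X := Quot.mk _ a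

section metric

variable {P : Set Cell} {X : SquaMS.{u}}

open Classical in
/-- The contribution of one step of a path in `P × X`: zero between identified points, and
otherwise `1/3` of the distance within one copy of `X`, and `2` between different copies. -/
noncomputable def stepScore (a b : P × X) : ℝ :=
  if Tensor.mk a = Tensor.mk b then 0 else if a.1 = b.1 then 1 / 3 * dist a.2 b.2 else 2

/-- The score of the path from `a` to `b` with the given list of intermediate points. -/
noncomputable def pathScore : P × X → List (P × X) → P × X → ℝ
  | a, [], b => stepScore a b
  | a, c :: l, b => stepScore a c + pathScore c l b

/-- The infimum of the scores of all finite paths from `a` to `b`. -/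
noncomputable def pathDist (a b : P × X) : ℝ := ⨅ l : List (P × X), pathScore a l b

theorem stepScore_eq_zero {a b : P × X} (h : Tensor.mk a = Tensor.mk b) : stepScore a b = 0 := by
  simp [stepScore, h]

theorem stepScore_nonneg (a b : P × X) : 0 ≤ stepScore a b := by
  unfold stepScore; split_ifs <;> positivity

theorem stepScore_comm (a b : P × X) : stepScore a b = stepScore b a := by
  by_cases h : Tensor.mk a = Tensor.mk b
  · rw [stepScore_eq_zero h, stepScore_eq_zero h.symm]
  · by_cases h' : a.1 = b.1
    · simp [stepScore, h, Ne.symm h, h', dist_comm]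
    · simp [stepScore, h, Ne.symm h, h', Ne.symm h']

theorem stepScore_le (m : P) (x y : X) : stepScore (m, x) (m, y) ≤ 1 / 3 * dist x y := by
  unfold stepScore; split_ifs with h1 h2
  · positivity
  · exact le_rfl
  · exact absurd rfl h2

theorem stepScore_le_two (a b : P × X) : stepScore a b ≤ 2 := by
  have := X.dist_le_two a.2 b.2
  unfold stepScore; split_ifs <;> linarith

theorem pathScore_nonneg (a b : P × X) (l : List (P × X)) : 0 ≤ pathScore a l b := by
  induction l generalizing a with
  | nil => exact stepScore_nonneg a b
  | cons c l ih => exact add_nonneg (stepScore_nonneg a c) (ih c)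

theorem pathScore_append (a b c : P × X) (l l' : List (P × X)) :
    pathScore a (l ++ c :: l') b = pathScore a l c + pathScore c l' b := by
  induction l generalizing a with
  | nil => rfl
  | cons d l ih => simp only [List.cons_append, pathScore, ih]; ring

theorem pathScore_reverse (a b : P × X) (l : List (P × X)) :
    pathScore b l.reverse a = pathScore a l b := by
  induction l generalizing a with
  | nil => exact stepScore_comm b a
  | cons c l ih =>
    rw [List.reverse_cons, pathScore_append, ih]
    simp only [pathScore]
    rw [stepScore_comm c a, add_comm]

theorem bddBelow_pathScore (a b : P × X) :
    BddBelow (Set.range fun l : List (P × X) => pathScore a l b) :=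
  ⟨0, by rintro _ ⟨l, rfl⟩; exact pathScore_nonneg a b l⟩

theorem pathDist_le (a b : P × X) (l : List (P × X)) : pathDist a b ≤ pathScore a l b :=
  ciInf_le (bddBelow_pathScore a b) l

theorem pathDist_le_step (a b : P × X) : pathDist a b ≤ stepScore a b := pathDist_le a b []

theorem pathDist_nonneg (a b : P × X) : 0 ≤ pathDist a b :=
  le_ciInf (pathScore_nonneg a b)

theorem pathDist_comm (a b : P × X) : pathDist a b = pathDist b a := by
  have key : ∀ a b : P × X, pathDist a b ≤ pathDist b a := fun a b =>
    le_ciInf fun l => by rw [← pathScore_reverse]; exact pathDist_le _ _ _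
  exact le_antisymm (key a b) (key b a)

theorem pathDist_triangle (a b c : P × X) : pathDist a c ≤ pathDist a b + pathDist b c :=
  le_ciInf_add_ciInf fun l l' => by rw [← pathScore_append]; exact pathDist_le _ _ _

theorem pathDist_eq_zero {a b : P × X} (h : Tensor.mk a = Tensor.mk b) : pathDist a b = 0 :=
  le_antisymm ((pathDist_le_step a b).trans_eq (stepScore_eq_zero h)) (pathDist_nonneg a b)

theorem pathDist_congr {a a' : P × X} (h : Tensor.mk a = Tensor.mk a') (b : P × X) :
    pathDist a b = pathDist a' b := by
  have h1 := pathDist_triangle a a' b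
  have h2 := pathDist_triangle a' a b
  rw [pathDist_eq_zero h] at h1
  rw [pathDist_eq_zero h.symm] at h2
  linarith

/-- A map to a metric space that does not expand any step does not expand the path distance. -/
theorem dist_le_pathDist {Y : Type*} [PseudoMetricSpace Y] (f : P × X → Y)
    (hf : ∀ a b, dist (f a) (f b) ≤ stepScore a b) (a b : P × X) :
    dist (f a) (f b) ≤ pathDist a b := by
  refine le_ciInf fun l => ?_
  induction l generalizing a with
  | nil => exact hf a b
  | cons c l ih => exact (dist_triangle _ (f c) _).trans (add_le_add (hf a c) (ih c))

/-- The quotient metric on `P ⊗ X`: the infimum of the scores of all paths. -/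
noncomputable instance : PseudoMetricSpace (Tensor P X) where
  dist := Quot.lift (fun a => Quot.lift (fun b => pathDist a b)
      (fun b b' h => by
        rw [pathDist_comm a b, pathDist_comm a b']; exact pathDist_congr (Quot.sound h) a))
    (fun a a' h => by
      funext t; induction t using Quot.ind with
      | mk b => exact pathDist_congr (Quot.sound h) b)
  dist_self t := by
    induction t using Quot.ind with
    | mk a => exact pathDist_eq_zero rfl
  dist_comm s t := by
    induction s using Quot.ind with
    | mk a => induction t using Quot.ind with
      | mk b => exact pathDist_comm a b
  dist_triangle s t v := by
    induction s using Quot.ind with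
    | mk a => induction t using Quot.ind with
      | mk b => induction v using Quot.ind with
        | mk c => exact pathDist_triangle a b c

theorem dist_mk (a b : P × X) : dist (Tensor.mk a) (Tensor.mk b) = pathDist a b := rfl

theorem dist_tensor_le_two (s t : Tensor P X) : dist s t ≤ 2 := by
  induction s using Quot.ind with
  | mk a => induction t using Quot.ind with
    | mk b => exact (pathDist_le_step a b).trans (stepScore_le_two a b)

theorem dist_mk_le (m : P) (x y : X) :
    dist (Tensor.mk (m, x)) (Tensor.mk (m, y)) ≤ 1 / 3 * dist x y :=
  (pathDist_le_step _ _).trans (stepScore_le m x y)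

/-- A real function on `P × X` which respects the gluing, is `1/3`-Lipschitz on each copy of `X` and
has oscillation at most `2`, bounds the distance from below. -/
theorem abs_sub_le_pathDist (F : P × X → ℝ) (h1 : ∀ a b, GlueRel P X a b → F a = F b)
    (h2 : ∀ m x y, |F (m, x) - F (m, y)| ≤ 1 / 3 * dist x y)
    (h3 : ∀ a b, |F a - F b| ≤ 2) (a b : P × X) : |F a - F b| ≤ pathDist a b := by
  rw [← Real.dist_eq]
  refine dist_le_pathDist F (fun a b => ?_) a b
  rw [Real.dist_eq]
  unfold stepScore
  split_ifs with h h'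
  · have : F a = F b := congrArg (Quot.lift F h1) h
    simp [this]
  · obtain ⟨m, x⟩ := a
    obtain ⟨n, y⟩ := b
    obtain rfl : m = n := h'
    exact h2 m x y
  · exact h3 a b

end metric

/-! ### The coordinates of `P ⊗ X` -/

section coordinates

/-- The point `shrink (i, j) = (i/3, j/3)`. -/
noncomputable def shrink (m : Cell) : Plane := WithLp.toLp 1 ((m.1.val : ℝ) / 3, (m.2.val : ℝ) / 3)

/-- The contraction `σ_m` of the plane, `p ↦ shrink m + p / 3`. -/
noncomputable def contraction (m : Cell) (p : Plane) : Plane := shrink m + (1 / 3 : ℝ) • p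

theorem contraction_fst (m : Cell) (p : Plane) :
    (contraction m p).fst = (m.1.val + p.fst) / 3 := by
  simp [contraction, shrink]; ring

theorem contraction_snd (m : Cell) (p : Plane) :
    (contraction m p).snd = (m.2.val + p.snd) / 3 := by
  simp [contraction, shrink]; ring

theorem contraction_eq_of_glued {m n : Cell} {p q : boundary} (h : Glued m n p q) :
    contraction m p = contraction n q := by
  obtain ⟨h1, h2, h3, h4, h5⟩ | ⟨h1, h2, h3, h4, h5⟩ := h
  · apply plane_ext
    · rw [contraction_fst, contraction_fst, h1, h3, h4]; push_cast; ring
    · rw [contraction_snd, contraction_snd, h2, h5]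
  · apply plane_ext
    · rw [contraction_fst, contraction_fst, h1, h5]
    · rw [contraction_snd, contraction_snd, h2, h3, h4]; push_cast; ring

theorem contraction_injective (m : Cell) : Function.Injective (contraction m) := by
  intro p q h
  have h1 := congrArg WithLp.fst h
  have h2 := congrArg WithLp.snd h
  rw [contraction_fst, contraction_fst] at h1
  rw [contraction_snd, contraction_snd] at h2
  apply plane_ext <;> linarith

theorem dist_contraction (m : Cell) (p q : Plane) :
    dist (contraction m p) (contraction m q) = 1 / 3 * dist p q := by
  simp [contraction, dist_smul₀]

theorem cell_le_two (i : Fin 3) : (i.val : ℝ) ≤ 2 := by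
  have := i.isLt
  exact_mod_cast (by omega : i.val ≤ 2)

theorem contraction_mem (m : Cell) {p : Plane} (hp : p ∈ unitSquare) :
    contraction m p ∈ unitSquare := by
  obtain ⟨h1, h2, h3, h4⟩ := hp
  have hi := cell_le_two m.1
  have hj := cell_le_two m.2
  have hi0 : (0 : ℝ) ≤ m.1.val := by positivity
  have hj0 : (0 : ℝ) ≤ m.2.val := by positivity
  refine ⟨?_, ?_, ?_, ?_⟩ <;> simp only [contraction_fst, contraction_snd] <;> linarith

/-- The function `(r, s) ↦ r ± s` on the boundary extends to a short function on `X` with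
the same bounds. -/
theorem exists_short_extension (X : SquaMS.{u}) (e c : ℝ)
    (he : (e = 1 ∧ c = 0) ∨ (e = -1 ∧ c = -1)) :
    ∃ f : X → ℝ, (∀ x y, |f x - f y| ≤ dist x y) ∧
      (∀ p : boundary, f (X.S p) = p.1.fst + e * p.1.snd) ∧ ∀ x, c ≤ f x ∧ f x ≤ c + 2 := by
  set g : X → ℝ := Function.extend X.S (fun p => p.1.fst + e * p.1.snd) 0 with hg
  have hgS : ∀ p, g (X.S p) = p.1.fst + e * p.1.snd := fun p => X.S_injective.extend_apply _ _ _
  have hlip : LipschitzOnWith 1 g (Set.range X.S) := by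
    apply LipschitzOnWith.of_dist_le_mul
    rintro _ ⟨p, rfl⟩ _ ⟨q, rfl⟩
    rw [hgS, hgS, Real.dist_eq, NNReal.coe_one, one_mul]
    refine le_trans ?_ (X.sq2 p q)
    rcases he with ⟨rfl, -⟩ | ⟨rfl, -⟩
    · calc _ = |(p.1.fst - q.1.fst) + (p.1.snd - q.1.snd)| := by congr 1; ring
        _ ≤ _ := abs_add_le _ _
    · calc _ = |(p.1.fst - q.1.fst) - (p.1.snd - q.1.snd)| := by congr 1; ring
        _ ≤ _ := abs_sub _ _
  obtain ⟨k, hk, hkg⟩ := hlip.extend_real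
  refine ⟨fun x => max c (min (c + 2) (k x)), fun x y => ?_, fun p => ?_, fun x => ?_⟩
  · have h := hk.dist_le_mul x y
    rw [Real.dist_eq, NNReal.coe_one, one_mul] at h
    refine le_trans ?_ h
    refine (abs_max_sub_max_le_max _ _ _ _).trans ?_
    refine max_le (by simp) ?_
    refine (abs_min_sub_min_le_max _ _ _ _).trans ?_
    exact max_le (by simp) le_rfl
  · have h : k (X.S p) = p.1.fst + e * p.1.snd := by rw [← hkg ⟨p, rfl⟩, hgS]
    obtain ⟨h1, h2, h3, h4⟩ := p.2.1
    simp only [h]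
    rw [min_eq_right, max_eq_right] <;> rcases he with ⟨rfl, rfl⟩ | ⟨rfl, rfl⟩ <;> linarith
  · exact ⟨le_max_left _ _, max_le (by linarith) (min_le_left _ _)⟩

variable {P : Set Cell} {X : SquaMS.{u}}

theorem abs_combination_le (e c : ℝ) (he : (e = 1 ∧ c = 0) ∨ (e = -1 ∧ c = -1))
    (m n : P) (p q : boundary) :
    |((contraction m p).fst + e * (contraction m p).snd) -
      ((contraction n q).fst + e * (contraction n q).snd)| ≤
      pathDist (X := X) (m, X.S p) (n, X.S q) := by
  obtain ⟨f, hf1, hf2, hf3⟩ := exists_short_extension X e c he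
  have key := abs_sub_le_pathDist (P := P) (X := X)
    (fun a => (a.1.1.1.val + e * a.1.1.2.val + f a.2) / 3) ?_ ?_ ?_ (m, X.S p) (n, X.S q)
  · refine le_trans (le_of_eq ?_) key
    simp only [contraction_fst, contraction_snd, hf2]
    congr 1; ring
  · rintro ⟨m, x⟩ ⟨n, y⟩ ⟨p, q, rfl, rfl, h⟩
    have h1 := congrArg WithLp.fst (contraction_eq_of_glued h)
    have h2 := congrArg WithLp.snd (contraction_eq_of_glued h)
    simp only [contraction_fst, contraction_snd] at h1 h2
    simp only [hf2]
    linear_combination h1 + e * h2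
  · intro m x y
    have := hf1 x y
    rw [abs_le] at this ⊢
    constructor <;> linarith [this.1, this.2]
  · rintro ⟨m, x⟩ ⟨n, y⟩
    have a1 := cell_le_two m.1.1
    have a2 := cell_le_two m.1.2
    have a3 := cell_le_two n.1.1
    have a4 := cell_le_two n.1.2
    have b1 : (0 : ℝ) ≤ m.1.1.val := by positivity
    have b2 : (0 : ℝ) ≤ m.1.2.val := by positivity
    have b3 : (0 : ℝ) ≤ n.1.1.val := by positivity
    have b4 : (0 : ℝ) ≤ n.1.2.val := by positivity
    have := hf3 x
    have := hf3 y
    rw [abs_le]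
    rcases he with ⟨rfl, rfl⟩ | ⟨rfl, rfl⟩ <;> constructor <;> linarith

/-- Distances between boundary points of copies of `X` are bounded below by the taxicab distance. -/
theorem dist_contraction_le (m n : P) (p q : boundary) :
    dist (contraction m p) (contraction n q) ≤ pathDist (X := X) (m, X.S p) (n, X.S q) := by
  have h1 := abs_combination_le (X := X) 1 0 (Or.inl ⟨rfl, rfl⟩) m n p q
  have h2 := abs_combination_le (X := X) (-1) (-1) (Or.inr ⟨rfl, rfl⟩) m n p q
  rw [dist_plane]
  rw [abs_le] at h1 h2
  rcases abs_cases ((contraction m p).fst - (contraction n q).fst) with ⟨h, -⟩ | ⟨h, -⟩ <;>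
  rcases abs_cases ((contraction m p).snd - (contraction n q).snd) with ⟨h', -⟩ | ⟨h', -⟩ <;>
  rw [h, h'] <;> linarith [h1.1, h1.2, h2.1, h2.2]

end coordinates

/-! ### `M ⊗ X` is a metric space -/

section separation

variable {X : SquaMS.{u}}

theorem mk_eq_of_glued {P : Set Cell} {m n : P} {p q : boundary} (h : Glued m n p q) :
    Tensor.mk (X := X) (m, X.S p) = Tensor.mk (n, X.S q) :=
  Quot.sound ⟨p, q, rfl, rfl, h⟩

theorem corner_mem {a b : ℝ} (ha : a = 0 ∨ a = 1) (hb : b = 0 ∨ b = 1) :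
    (WithLp.toLp 1 (a, b) : Plane) ∈ boundary := by
  refine ⟨?_, ?_⟩
  · rcases ha with rfl | rfl <;> rcases hb with rfl | rfl <;> simp [unitSquare]
  · rcases ha with rfl | rfl <;> simp

theorem mk_eq_of_contraction_eq_aux (m n : M) (p q : boundary)
    (h : contraction m p = contraction n q)
    (hmn : n.1.1.val = m.1.1.val + 1 ∨ (n.1.1 = m.1.1 ∧ n.1.2.val = m.1.2.val + 1)) :
    Tensor.mk (X := X) (m, X.S p) = Tensor.mk (n, X.S q) := by
  have h1 := congrArg WithLp.fst h
  have h2 := congrArg WithLp.snd h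
  simp only [contraction_fst, contraction_snd] at h1 h2
  obtain ⟨p1, p2, p3, p4⟩ := p.2.1
  obtain ⟨q1, q2, q3, q4⟩ := q.2.1
  rcases hmn with hc | ⟨hc, hr⟩
  · rw [hc] at h1; push_cast at h1
    have e1 : p.1.fst = 1 := by linarith
    have e2 : q.1.fst = 0 := by linarith
    have b1 : m.1.2.val ≤ n.1.2.val + 1 := by
      have : (m.1.2.val : ℝ) ≤ n.1.2.val + 1 := by linarith
      exact_mod_cast this
    have b2 : n.1.2.val ≤ m.1.2.val + 1 := by
      have : (n.1.2.val : ℝ) ≤ m.1.2.val + 1 := by linarith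
      exact_mod_cast this
    obtain hr | hr | hr : n.1.2.val = m.1.2.val ∨ n.1.2.val = m.1.2.val + 1 ∨
      m.1.2.val = n.1.2.val + 1 := by omega
    · rw [hr] at h2
      exact mk_eq_of_glued (Or.inl ⟨hc, Fin.ext hr, e1, e2, by linarith⟩)
    · rw [hr] at h2; push_cast at h2
      have e3 : p.1.snd = 1 := by linarith
      have e4 : q.1.snd = 0 := by linarith
      by_cases hM : ((n.1.1, m.1.2) : Cell) ∈ M
      · have c := corner_mem (a := 0) (b := 1) (Or.inl rfl) (Or.inr rfl)
        exact (mk_eq_of_glued (m := m) (p := p) (n := ⟨_, hM⟩) (q := ⟨_, c⟩)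
          (Or.inl ⟨hc, rfl, e1, rfl, e3⟩)).trans
          (mk_eq_of_glued (m := ⟨_, hM⟩) (p := ⟨_, c⟩) (n := n) (q := q)
            (Or.inr ⟨rfl, hr, rfl, e4, e2.symm⟩))
      · have hM' : ((m.1.1, n.1.2) : Cell) ∈ M := by
          intro h'
          simp only [M, Set.mem_ofPred_eq, not_not, Prod.mk.injEq] at hM h'
          rw [hM.1, h'.1] at hc; simp at hc
        have c := corner_mem (a := 1) (b := 0) (Or.inr rfl) (Or.inl rfl)
        exact (mk_eq_of_glued (m := m) (p := p) (n := ⟨_, hM'⟩) (q := ⟨_, c⟩)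
          (Or.inr ⟨rfl, hr, e3, rfl, e1⟩)).trans
          (mk_eq_of_glued (m := ⟨_, hM'⟩) (p := ⟨_, c⟩) (n := n) (q := q)
            (Or.inl ⟨hc, rfl, rfl, e2, e4.symm⟩))
    · rw [hr] at h2; push_cast at h2
      have e3 : p.1.snd = 0 := by linarith
      have e4 : q.1.snd = 1 := by linarith
      by_cases hM : ((n.1.1, m.1.2) : Cell) ∈ M
      · have c := corner_mem (a := 0) (b := 0) (Or.inl rfl) (Or.inl rfl)
        exact (mk_eq_of_glued (m := m) (p := p) (n := ⟨_, hM⟩) (q := ⟨_, c⟩)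
          (Or.inl ⟨hc, rfl, e1, rfl, e3⟩)).trans
          (mk_eq_of_glued (m := n) (p := q) (n := ⟨_, hM⟩) (q := ⟨_, c⟩)
            (Or.inr ⟨rfl, hr, e4, rfl, e2⟩)).symm
      · have hM' : ((m.1.1, n.1.2) : Cell) ∈ M := by
          intro h'
          simp only [M, Set.mem_ofPred_eq, not_not, Prod.mk.injEq] at hM h'
          rw [hM.1, h'.1] at hc; simp at hc
        have c := corner_mem (a := 1) (b := 1) (Or.inr rfl) (Or.inr rfl)
        exact (mk_eq_of_glued (m := ⟨_, hM'⟩) (p := ⟨_, c⟩) (n := m) (q := p)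
          (Or.inr ⟨rfl, hr, rfl, e3, e1.symm⟩)).symm.trans
          (mk_eq_of_glued (m := ⟨_, hM'⟩) (p := ⟨_, c⟩) (n := n) (q := q)
            (Or.inl ⟨hc, rfl, rfl, e2, e4.symm⟩))
  · rw [hc] at h1
    rw [hr] at h2; push_cast at h2
    exact mk_eq_of_glued (Or.inr ⟨hc, hr, by linarith, by linarith, by linarith⟩)

/-- Boundary points of copies of `X` which have the same position in the square are identified. -/
theorem mk_eq_of_contraction_eq (m n : M) (p q : boundary)
    (h : contraction m p = contraction n q) :
    Tensor.mk (X := X) (m, X.S p) = Tensor.mk (n, X.S q) := by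
  by_cases hmn : m = n
  · subst hmn
    rw [Subtype.ext (contraction_injective _ h)]
  have h1 := congrArg WithLp.fst h
  have h2 := congrArg WithLp.snd h
  simp only [contraction_fst, contraction_snd] at h1 h2
  obtain ⟨p1, p2, p3, p4⟩ := p.2.1
  obtain ⟨q1, q2, q3, q4⟩ := q.2.1
  have b1 : m.1.1.val ≤ n.1.1.val + 1 := by
    have : (m.1.1.val : ℝ) ≤ n.1.1.val + 1 := by linarith
    exact_mod_cast this
  have b2 : n.1.1.val ≤ m.1.1.val + 1 := by
    have : (n.1.1.val : ℝ) ≤ m.1.1.val + 1 := by linarith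
    exact_mod_cast this
  have b3 : m.1.2.val ≤ n.1.2.val + 1 := by
    have : (m.1.2.val : ℝ) ≤ n.1.2.val + 1 := by linarith
    exact_mod_cast this
  have b4 : n.1.2.val ≤ m.1.2.val + 1 := by
    have : (n.1.2.val : ℝ) ≤ m.1.2.val + 1 := by linarith
    exact_mod_cast this
  have hne : ¬ (m.1.1 = n.1.1 ∧ m.1.2 = n.1.2) := fun h => hmn (Subtype.ext (Prod.ext h.1 h.2))
  simp only [Fin.ext_iff] at hne
  by_cases hd : n.1.1.val = m.1.1.val + 1 ∨ (n.1.1 = m.1.1 ∧ n.1.2.val = m.1.2.val + 1)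
  · exact mk_eq_of_contraction_eq_aux m n p q h hd
  · refine (mk_eq_of_contraction_eq_aux n m q p h.symm ?_).symm
    simp only [Fin.ext_iff] at hd ⊢
    omega

theorem isCompact_unitSquare : IsCompact unitSquare := by
  have : unitSquare = WithLp.toLp 1 '' (Set.Icc (0 : ℝ) 1 ×ˢ Set.Icc (0 : ℝ) 1) := by
    ext p
    constructor
    · rintro ⟨h1, h2, h3, h4⟩
      exact ⟨(p.fst, p.snd), ⟨⟨h1, h2⟩, ⟨h3, h4⟩⟩, rfl⟩
    · rintro ⟨q, ⟨⟨h1, h2⟩, ⟨h3, h4⟩⟩, rfl⟩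
      exact ⟨h1, h2, h3, h4⟩
  rw [this]
  exact (isCompact_Icc.prod isCompact_Icc).image (WithLp.prod_continuous_toLp 1 ℝ ℝ)

theorem continuous_plane_fst : Continuous fun p : Plane => p.fst :=
  continuous_fst.comp (WithLp.prod_continuous_ofLp 1 ℝ ℝ)

theorem continuous_plane_snd : Continuous fun p : Plane => p.snd :=
  continuous_snd.comp (WithLp.prod_continuous_ofLp 1 ℝ ℝ)

theorem isCompact_boundary : IsCompact boundary := by
  have : boundary = unitSquare ∩ {p | p.fst = 0 ∨ p.fst = 1 ∨ p.snd = 0 ∨ p.snd = 1} := rfl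
  rw [this]
  refine isCompact_unitSquare.inter_right ?_
  exact (isClosed_eq continuous_plane_fst continuous_const).union
    ((isClosed_eq continuous_plane_fst continuous_const).union
      ((isClosed_eq continuous_plane_snd continuous_const).union
        (isClosed_eq continuous_plane_snd continuous_const)))

theorem dist_S_le_of_corner (X : SquaMS.{u}) (p q : boundary)
    (hp : p.1.fst = 0 ∨ p.1.fst = 1) (hq : q.1.snd = 0 ∨ q.1.snd = 1) :
    dist (X.S p) (X.S q) ≤ 2 * dist p q := by
  have h1 := X.sq1_vertical p ⟨_, corner_mem hp hq⟩ rfl hp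
  have h2 := X.sq1_horizontal q ⟨_, corner_mem hp hq⟩ rfl hq
  have h3 := dist_triangle_right (X.S p) (X.S q) (X.S ⟨_, corner_mem hp hq⟩)
  rw [h1, h2] at h3
  change _ ≤ |q.1.snd - p.1.snd| + |p.1.fst - q.1.fst| at h3
  rw [abs_sub_comm q.1.snd p.1.snd] at h3
  rw [Subtype.dist_eq, dist_plane]
  have := abs_nonneg (p.1.fst - q.1.fst)
  have := abs_nonneg (p.1.snd - q.1.snd)
  linarith

/-- The map `S` is Lipschitz. -/
theorem dist_S_le (X : SquaMS.{u}) (p q : boundary) :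
    dist (X.S p) (X.S q) ≤ 2 * dist p q := by
  have hd : dist p q = |p.1.fst - q.1.fst| + |p.1.snd - q.1.snd| := dist_plane _ _
  have n1 := abs_nonneg (p.1.fst - q.1.fst)
  have n2 := abs_nonneg (p.1.snd - q.1.snd)
  have hp : (p.1.fst = 0 ∨ p.1.fst = 1) ∨ (p.1.snd = 0 ∨ p.1.snd = 1) := by
    have := p.2.2; tauto
  have hq : (q.1.fst = 0 ∨ q.1.fst = 1) ∨ (q.1.snd = 0 ∨ q.1.snd = 1) := by
    have := q.2.2; tauto
  rcases hp with hp | hp <;> rcases hq with hq | hq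
  · by_cases h : p.1.fst = q.1.fst
    · rw [X.sq1_vertical p q h hp, hd, abs_sub_comm]; linarith
    · have : |p.1.fst - q.1.fst| = 1 := by
        rcases hp with hp | hp <;> rcases hq with hq | hq <;> simp_all
      have := X.dist_le_two (X.S p) (X.S q)
      linarith
  · exact dist_S_le_of_corner X p q hp hq
  · rw [dist_comm, dist_comm p]; exact dist_S_le_of_corner X q p hq hp
  · by_cases h : p.1.snd = q.1.snd
    · rw [X.sq1_horizontal p q h hp, hd, abs_sub_comm]; linarith
    · have : |p.1.snd - q.1.snd| = 1 := by
        rcases hp with hp | hp <;> rcases hq with hq | hq <;> simp_all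
      have := X.dist_le_two (X.S p) (X.S q)
      linarith

theorem isClosed_range_S (X : SquaMS.{u}) : IsClosed (Set.range X.S) := by
  have : CompactSpace boundary := isCompact_iff_compactSpace.1 isCompact_boundary
  have h : LipschitzWith 2 X.S := LipschitzWith.of_dist_le_mul (dist_S_le X)
  exact (isCompact_range h.continuous).isClosed

/-- A point of `M × X` off the boundary of its copy of `X` has positive distance from all other
points. -/
theorem pathDist_pos_of_notMem {P : Set Cell} {a b : P × X} (h : a ≠ b)
    (ha : a.2 ∉ Set.range X.S) : 0 < pathDist a b := by
  classical
  obtain ⟨m, x⟩ := a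
  obtain ⟨n, y⟩ := b
  obtain ⟨δ, hδ, hball⟩ := Metric.isOpen_iff.1 (isClosed_range_S X).isOpen_compl x ha
  set ρ : ℝ := min δ 2
  have hρ : 0 < ρ := lt_min hδ two_pos
  have hS : ∀ p, ρ ≤ dist x (X.S p) := fun p => by
    by_contra hlt
    push Not at hlt
    exact hball (show X.S p ∈ Metric.ball x δ by
      rw [Metric.mem_ball, dist_comm]; exact hlt.trans_le (min_le_left _ _)) ⟨p, rfl⟩
  set F : P × X → ℝ := fun c => if c.1 = m then 1 / 3 * max 0 (ρ - dist x c.2) else 0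
  have hF0 : ∀ c, 0 ≤ F c := fun c => by
    simp only [F]; split_ifs <;> positivity
  have hF2 : ∀ c, F c ≤ 2 := fun c => by
    simp only [F]; split_ifs
    · have : max 0 (ρ - dist x c.2) ≤ 2 :=
        max_le two_pos.le (by linarith [dist_nonneg (x := x) (y := c.2), min_le_right δ 2])
      linarith
    · exact two_pos.le
  have hFS : ∀ (n : P) p, F (n, X.S p) = 0 := fun n p => by
    simp only [F]; split_ifs
    · rw [max_eq_left (by linarith [hS p]), mul_zero]
    · rfl
  have key := abs_sub_le_pathDist F ?_ ?_ ?_ (m, x) (n, y)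
  · refine lt_of_lt_of_le (abs_pos.2 (sub_ne_zero.2 (ne_of_gt ?_))) key
    have e : F (m, x) = 1 / 3 * ρ := by simp [F, hρ.le]
    rw [e]
    simp only [F]
    split_ifs with hnm
    · have hxy : x ≠ y := fun hxy => h (by rw [hnm, hxy])
      have := dist_pos.2 hxy
      have : max 0 (ρ - dist x y) < ρ := max_lt hρ (by linarith)
      linarith
    · positivity
  · rintro ⟨m', _⟩ ⟨n', _⟩ ⟨p, q, rfl, rfl, -⟩
    rw [hFS, hFS]
  · intro m' z w
    simp only [F]
    split_ifs
    · rw [← mul_sub, abs_mul, abs_of_pos (by norm_num : (0 : ℝ) < 1 / 3)]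
      refine mul_le_mul_of_nonneg_left ?_ (by norm_num)
      refine (abs_max_sub_max_le_max _ _ _ _).trans (max_le (by simp) ?_)
      rw [show ρ - dist x z - (ρ - dist x w) = dist x w - dist x z by ring, dist_comm x w,
        dist_comm x z, dist_comm z w]
      exact abs_dist_sub_le _ _ _
    · simp only [sub_self, abs_zero]; positivity
  · intro c d
    rw [abs_le]
    constructor <;> linarith [hF0 c, hF0 d, hF2 c, hF2 d]

theorem pathDist_pos {a b : M × X} (h : Tensor.mk a ≠ Tensor.mk b) : 0 < pathDist a b := by
  have hne : a ≠ b := fun hab => h (congrArg _ hab)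
  by_cases ha : a.2 ∈ Set.range X.S
  · by_cases hb : b.2 ∈ Set.range X.S
    · obtain ⟨m, x⟩ := a
      obtain ⟨n, y⟩ := b
      obtain ⟨p, rfl⟩ := ha
      obtain ⟨q, rfl⟩ := hb
      refine lt_of_lt_of_le ?_ (dist_contraction_le m n p q)
      exact dist_pos.2 fun he => h (mk_eq_of_contraction_eq m n p q he)
    · rw [pathDist_comm]
      exact pathDist_pos_of_notMem hne.symm hb
  · exact pathDist_pos_of_notMem hne ha

end separation

noncomputable instance (X : SquaMS.{u}) : MetricSpace (Tensor M X) where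
  eq_of_dist_eq_zero {s t} h := by
    induction s using Quot.ind with
    | mk a => induction t using Quot.ind with
      | mk b =>
        by_contra hne
        exact (pathDist_pos hne).ne' h

/-! ### The functor `M ⊗ -` -/

section functor

/-- The third of the unit interval that contains the number `r`. -/
noncomputable def third (r : ℝ) : Fin 3 := if r ≤ 1 / 3 then 0 else if r ≤ 2 / 3 then 1 else 2

theorem third_bounds {r : ℝ} (h0 : 0 ≤ r) (h1 : r ≤ 1) :
    0 ≤ 3 * r - (third r).val ∧ 3 * r - (third r).val ≤ 1 := by
  unfold third; split_ifs <;> norm_num <;> constructor <;> linarith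

theorem third_zero : third 0 = 0 := by simp [third]

theorem third_one : third 1 = 2 := by norm_num [third]

/-- The cell of the boundary point `(r, s)`. -/
noncomputable def cellOf (p : boundary) : M :=
  ⟨(third p.1.fst, third p.1.snd), by
    intro h
    have h1 : third p.1.fst = 1 := congrArg Prod.fst h
    have h2 : third p.1.snd = 1 := congrArg Prod.snd h
    rcases p.2.2 with h | h | h | h <;> simp [h, third_zero, third_one] at h1 h2⟩

/-- The rescaled coordinates of a boundary point within its cell. -/
noncomputable def localPoint (p : boundary) : boundary :=
  ⟨WithLp.toLp 1 (3 * p.1.fst - (third p.1.fst).val, 3 * p.1.snd - (third p.1.snd).val), by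
    obtain ⟨h1, h2, h3, h4⟩ := p.2.1
    obtain ⟨a1, a2⟩ := third_bounds h1 h2
    obtain ⟨b1, b2⟩ := third_bounds h3 h4
    refine ⟨⟨a1, a2, b1, b2⟩, ?_⟩
    rcases p.2.2 with h | h | h | h <;> rw [h] <;> norm_num [third_zero, third_one]⟩

theorem contraction_localPoint (p : boundary) : contraction (cellOf p).1 (localPoint p).1 = p.1 := by
  apply plane_ext
  · rw [contraction_fst]; simp [cellOf, localPoint]
  · rw [contraction_snd]; simp [cellOf, localPoint]

/-- The boundary map of `M ⊗ X`: each side consists of three copies of that side of `X`. For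
instance, `(0, r)` goes to `(0, 0) ⊗ S (0, 3 r)` for `r ≤ 1/3`, to `(0, 1) ⊗ S (0, 3 r - 1)` for
`1/3 ≤ r ≤ 2/3`, and to `(0, 2) ⊗ S (0, 3 r - 2)` for `2/3 ≤ r`. -/
noncomputable def tensorS (X : SquaMS.{u}) (p : boundary) : Tensor M X :=
  Tensor.mk (cellOf p, X.S (localPoint p))

/-- The boundary map does not depend on the choice of a cell for the points on two cells. -/
theorem tensorS_eq (X : SquaMS.{u}) (p q : boundary) (m : M) (h : contraction m q = p) :
    tensorS X p = Tensor.mk (m, X.S q) :=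
  mk_eq_of_contraction_eq _ _ _ _ (by rw [contraction_localPoint, h])

theorem tensorS_sq2 (X : SquaMS.{u}) (p q : boundary) :
    |p.1.fst - q.1.fst| + |p.1.snd - q.1.snd| ≤ dist (tensorS X p) (tensorS X q) := by
  rw [← dist_plane, ← contraction_localPoint p, ← contraction_localPoint q]
  exact dist_contraction_le _ _ _ _

/-- A parametrised side of `M ⊗ X` consisting of three segments, each of which is isometric to a
segment of length `1/3`. -/
theorem dist_le_of_thirds {Y : Type*} [PseudoMetricSpace Y] (γ : ℝ → Y)
    (h : ∀ k : ℕ, k < 3 → ∀ r s : ℝ, (k : ℝ) / 3 ≤ r → r ≤ s → s ≤ (k + 1) / 3 →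
      dist (γ r) (γ s) ≤ s - r) (r s : ℝ) (hr : 0 ≤ r) (hrs : r ≤ s) (hs : s ≤ 1) :
    dist (γ r) (γ s) ≤ s - r := by
  have h0 := h 0 (by norm_num)
  have h1 := h 1 (by norm_num)
  have h2 := h 2 (by norm_num)
  norm_num at h0 h1 h2
  have two : ∀ r s : ℝ, 0 ≤ r → r ≤ s → s ≤ 2 / 3 → dist (γ r) (γ s) ≤ s - r := by
    intro r s hr hrs hs
    rcases le_total s (1 / 3) with c | c
    · exact h0 r s hr hrs c
    rcases le_total (1 / 3) r with d | d
    · exact h1 r s d hrs hs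
    · linarith [dist_triangle (γ r) (γ (1 / 3)) (γ s), h0 r (1 / 3) hr d le_rfl,
        h1 (1 / 3) s le_rfl c hs]
  rcases le_total s (2 / 3) with c | c
  · exact two r s hr hrs c
  rcases le_total (2 / 3) r with d | d
  · exact h2 r s d hrs hs
  · linarith [dist_triangle (γ r) (γ (2 / 3)) (γ s), two r (2 / 3) hr d le_rfl,
      h2 (2 / 3) s le_rfl c hs]

theorem vertical_mem {a r : ℝ} (ha : a = 0 ∨ a = 1) (h0 : 0 ≤ r) (h1 : r ≤ 1) :
    (WithLp.toLp 1 (a, r) : Plane) ∈ boundary :=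
  ⟨⟨by rcases ha with rfl | rfl <;> simp, by rcases ha with rfl | rfl <;> simp, h0, h1⟩, by
    rcases ha with rfl | rfl <;> simp⟩

theorem horizontal_mem {a r : ℝ} (ha : a = 0 ∨ a = 1) (h0 : 0 ≤ r) (h1 : r ≤ 1) :
    (WithLp.toLp 1 (r, a) : Plane) ∈ boundary :=
  ⟨⟨h0, h1, by rcases ha with rfl | rfl <;> simp, by rcases ha with rfl | rfl <;> simp⟩, by
    rcases ha with rfl | rfl <;> simp⟩

/-- The column or row of cells along a side. -/
theorem exists_side {a : ℝ} (ha : a = 0 ∨ a = 1) :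
    ∃ c : Fin 3, c ≠ 1 ∧ (c.val + a) / 3 = a := by
  rcases ha with rfl | rfl
  · exact ⟨0, by decide, by norm_num⟩
  · exact ⟨2, by decide, by norm_num⟩

theorem tensorS_vertical (X : SquaMS.{u}) {a r s : ℝ} (ha : a = 0 ∨ a = 1) (hr : 0 ≤ r)
    (hrs : r ≤ s) (hs : s ≤ 1) :
    dist (tensorS X ⟨_, vertical_mem ha hr (hrs.trans hs)⟩)
      (tensorS X ⟨_, vertical_mem ha (hr.trans hrs) hs⟩) ≤ s - r := by
  classical
  obtain ⟨c, hc, hca⟩ := exists_side ha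
  set γ : ℝ → Tensor M X := fun t =>
    if h : (WithLp.toLp 1 (a, t) : Plane) ∈ boundary then tensorS X ⟨_, h⟩
    else tensorS X ⟨_, corner_mem ha ha⟩ with hγ
  have key := dist_le_of_thirds γ ?_ r s hr hrs hs
  · simpa only [hγ, dif_pos (vertical_mem ha hr (hrs.trans hs)),
      dif_pos (vertical_mem ha (hr.trans hrs) hs)] using key
  · intro k hk r s hr hrs hs
    have hk0 : (0 : ℝ) ≤ k := by positivity
    have hk2 : (k : ℝ) ≤ 2 := by exact_mod_cast (by omega : k ≤ 2)
    have e : ∀ t : ℝ, ∀ h1 : (k : ℝ) / 3 ≤ t, ∀ h2 : t ≤ (k + 1) / 3,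
        γ t = Tensor.mk ((⟨(c, ⟨k, hk⟩), fun h => hc (congrArg Prod.fst h)⟩ : M),
          X.S ⟨_, vertical_mem (r := 3 * t - k) ha (by linarith) (by linarith)⟩) := by
      intro t h1 h2
      simp only [hγ]
      rw [dif_pos (vertical_mem ha (by linarith) (by linarith))]
      refine tensorS_eq _ _ _ _ (plane_ext ?_ ?_)
      · rw [contraction_fst]; exact hca
      · rw [contraction_snd]; simp
    rw [e r hr (hrs.trans hs), e s (hr.trans hrs) hs]
    refine (dist_mk_le _ _ _).trans (le_of_eq ?_)
    rw [X.sq1_vertical ⟨WithLp.toLp 1 (a, 3 * r - k), vertical_mem ha (by linarith) (by linarith)⟩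
      ⟨WithLp.toLp 1 (a, 3 * s - k), vertical_mem ha (by linarith) (by linarith)⟩ rfl ha]
    change 1 / 3 * |3 * s - k - (3 * r - k)| = s - r
    rw [abs_of_nonneg (by linarith)]; ring

theorem tensorS_horizontal (X : SquaMS.{u}) {a r s : ℝ} (ha : a = 0 ∨ a = 1) (hr : 0 ≤ r)
    (hrs : r ≤ s) (hs : s ≤ 1) :
    dist (tensorS X ⟨_, horizontal_mem ha hr (hrs.trans hs)⟩)
      (tensorS X ⟨_, horizontal_mem ha (hr.trans hrs) hs⟩) ≤ s - r := by
  classical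
  obtain ⟨c, hc, hca⟩ := exists_side ha
  set γ : ℝ → Tensor M X := fun t =>
    if h : (WithLp.toLp 1 (t, a) : Plane) ∈ boundary then tensorS X ⟨_, h⟩
    else tensorS X ⟨_, corner_mem ha ha⟩ with hγ
  have key := dist_le_of_thirds γ ?_ r s hr hrs hs
  · simpa only [hγ, dif_pos (horizontal_mem ha hr (hrs.trans hs)),
      dif_pos (horizontal_mem ha (hr.trans hrs) hs)] using key
  · intro k hk r s hr hrs hs
    have hk0 : (0 : ℝ) ≤ k := by positivity
    have hk2 : (k : ℝ) ≤ 2 := by exact_mod_cast (by omega : k ≤ 2)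
    have e : ∀ t : ℝ, ∀ h1 : (k : ℝ) / 3 ≤ t, ∀ h2 : t ≤ (k + 1) / 3,
        γ t = Tensor.mk ((⟨(⟨k, hk⟩, c), fun h => hc (congrArg Prod.snd h)⟩ : M),
          X.S ⟨_, horizontal_mem (r := 3 * t - k) ha (by linarith) (by linarith)⟩) := by
      intro t h1 h2
      simp only [hγ]
      rw [dif_pos (horizontal_mem ha (by linarith) (by linarith))]
      refine tensorS_eq _ _ _ _ (plane_ext ?_ ?_)
      · rw [contraction_fst]; simp
      · rw [contraction_snd]; exact hca
    rw [e r hr (hrs.trans hs), e s (hr.trans hrs) hs]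
    refine (dist_mk_le _ _ _).trans (le_of_eq ?_)
    rw [X.sq1_horizontal ⟨WithLp.toLp 1 (3 * r - k, a), horizontal_mem ha (by linarith) (by linarith)⟩
      ⟨WithLp.toLp 1 (3 * s - k, a), horizontal_mem ha (by linarith) (by linarith)⟩ rfl ha]
    change 1 / 3 * |3 * s - k - (3 * r - k)| = s - r
    rw [abs_of_nonneg (by linarith)]; ring

theorem tensorS_sq1_vertical (X : SquaMS.{u}) (p q : boundary) (h : p.1.fst = q.1.fst)
    (hp : p.1.fst = 0 ∨ p.1.fst = 1) :
    dist (tensorS X p) (tensorS X q) = |q.1.snd - p.1.snd| := by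
  have lower := tensorS_sq2 X p q
  rw [h, sub_self, abs_zero, zero_add, abs_sub_comm] at lower
  refine le_antisymm ?_ lower
  have ep : p = ⟨_, vertical_mem hp p.2.1.2.2.1 p.2.1.2.2.2⟩ := Subtype.ext rfl
  have eq : q = ⟨_, vertical_mem hp q.2.1.2.2.1 q.2.1.2.2.2⟩ :=
    Subtype.ext (plane_ext h.symm rfl)
  rcases le_total p.1.snd q.1.snd with hle | hle
  · rw [abs_of_nonneg (by linarith), ep, eq]
    exact tensorS_vertical X hp p.2.1.2.2.1 hle q.2.1.2.2.2
  · rw [abs_of_nonpos (by linarith), dist_comm, ep, eq, neg_sub]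
    exact tensorS_vertical X hp q.2.1.2.2.1 hle p.2.1.2.2.2

theorem tensorS_sq1_horizontal (X : SquaMS.{u}) (p q : boundary) (h : p.1.snd = q.1.snd)
    (hp : p.1.snd = 0 ∨ p.1.snd = 1) :
    dist (tensorS X p) (tensorS X q) = |q.1.fst - p.1.fst| := by
  have lower := tensorS_sq2 X p q
  rw [h, sub_self, abs_zero, add_zero, abs_sub_comm] at lower
  refine le_antisymm ?_ lower
  have ep : p = ⟨_, horizontal_mem hp p.2.1.1 p.2.1.2.1⟩ := Subtype.ext rfl
  have eq : q = ⟨_, horizontal_mem hp q.2.1.1 q.2.1.2.1⟩ :=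
    Subtype.ext (plane_ext rfl h.symm)
  rcases le_total p.1.fst q.1.fst with hle | hle
  · rw [abs_of_nonneg (by linarith), ep, eq]
    exact tensorS_horizontal X hp p.2.1.1 hle q.2.1.2.1
  · rw [abs_of_nonpos (by linarith), dist_comm, ep, eq, neg_sub]
    exact tensorS_horizontal X hp q.2.1.1 hle p.2.1.2.1

/-- The square metric space `M ⊗ X`. -/
noncomputable def tensorObj (X : SquaMS.{u}) : SquaMS.{u} where
  carrier := Tensor M X
  S := tensorS X
  S_injective p q h := by
    have := tensorS_sq2 X p q
    rw [h, dist_self, ← dist_plane] at this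
    exact Subtype.ext (dist_le_zero.1 this)
  dist_le_two := dist_tensor_le_two
  sq1_vertical := tensorS_sq1_vertical X
  sq1_horizontal := tensorS_sq1_horizontal X
  sq2 := tensorS_sq2 X

/-- The map `m ⊗ x ↦ m ⊗ f x`, for a map `f` which preserves `S`. -/
def tensorFun (P : Set Cell) {X Y : SquaMS.{u}} (f : X → Y) (hf : ∀ p, f (X.S p) = Y.S p) :
    Tensor P X → Tensor P Y :=
  Quot.map (fun a => (a.1, f a.2)) (by
    rintro ⟨m, _⟩ ⟨n, _⟩ ⟨p, q, rfl, rfl, h⟩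
    exact ⟨p, q, hf p, hf q, h⟩)

theorem dist_tensorFun_le (P : Set Cell) {X Y : SquaMS.{u}} (f : SquaMS.Hom X Y)
    (s t : Tensor P X) :
    dist (tensorFun P f.toFun f.map_S s) (tensorFun P f.toFun f.map_S t) ≤ dist s t := by
  induction s using Quot.ind with
  | mk a => induction t using Quot.ind with
    | mk b =>
      refine dist_le_pathDist (fun a => tensorFun P f.toFun f.map_S (Tensor.mk a)) ?_ a b
      intro a b
      by_cases h : Tensor.mk a = Tensor.mk b
      · rw [h, dist_self]; exact stepScore_nonneg a b
      · obtain ⟨m, x⟩ := a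
        obtain ⟨n, y⟩ := b
        simp only [stepScore, h, if_false]
        split_ifs with h'
        · subst h'
          exact (dist_mk_le m (f.toFun x) (f.toFun y)).trans
            (mul_le_mul_of_nonneg_left (f.short x y) (by norm_num))
        · exact dist_tensor_le_two _ _

/-- The functor `M ⊗ -` on square metric spaces. -/
noncomputable def tensorM : SquaMS.{u} ⥤ SquaMS.{u} where
  obj := tensorObj
  map {X Y} f := ⟨tensorFun M f.toFun f.map_S, dist_tensorFun_le M f,
    fun p => congrArg (fun y => Tensor.mk (cellOf p, y)) (f.map_S (localPoint p))⟩
  map_id X := by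
    refine SquaMS.Hom.ext (funext fun s => ?_)
    induction s using Quot.ind with
    | mk a => rfl
  map_comp f g := by
    refine SquaMS.Hom.ext (funext fun s => ?_)
    induction s using Quot.ind with
    | mk a => rfl

/-- An algebra `a : F A ⟶ A` is corecursive if for each coalgebra `e : X ⟶ F X` there is exactly one
coalgebra-to-algebra morphism, that is, one `h : X ⟶ A` with `h = a ∘ F h ∘ e`. -/
def IsCorecursive {C : Type*} [Category C] {F : C ⥤ C} (A : Endofunctor.Algebra F) : Prop :=
  ∀ X : Endofunctor.Coalgebra F, ∃! h : X.V ⟶ A.a, h = X.str ≫ F.map h ≫ A.str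

end functor

/-! ### The Sierpinski carpet -/

section carpet

/-- The map `σ(A) = ⋃_{m ∈ M} σ_m(A)` on subsets of the plane. -/
def hutchinson (A : Set Plane) : Set Plane := ⋃ m ∈ M, contraction m '' A

/-- The properties which characterise the Sierpinski carpet. -/
def IsCarpet (A : Set Plane) : Prop :=
  A ⊆ unitSquare ∧ A.Nonempty ∧ IsCompact A ∧ hutchinson A = A

theorem hutchinson_mono {A B : Set Plane} (h : A ⊆ B) : hutchinson A ⊆ hutchinson B :=
  Set.iUnion₂_mono fun _ _ => Set.image_mono h

theorem mem_hutchinson {A : Set Plane} {p : Plane} :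
    p ∈ hutchinson A ↔ ∃ m : M, ∃ q ∈ A, contraction m q = p := by
  simp [hutchinson]

theorem IsCarpet.subset {A B : Set Plane} (hA : IsCarpet A) (hB : IsCarpet B) : A ⊆ B := by
  obtain ⟨-, hA2, hA3, hA4⟩ := hA
  obtain ⟨-, hB2, hB3, hB4⟩ := hB
  obtain ⟨a, ha, hmax⟩ := hA3.exists_isMaxOn hA2 (Metric.continuous_infDist_pt B).continuousOn
  have h0 : Metric.infDist a B ≤ 0 := by
    have ha' := ha
    rw [← hA4, mem_hutchinson] at ha'
    obtain ⟨m, q, hq, rfl⟩ := ha'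
    obtain ⟨b, hb, hqb⟩ := hB3.exists_infDist_eq_dist hB2 q
    have h1 : contraction m b ∈ B := hB4.subset (mem_hutchinson.2 ⟨m, b, hb, rfl⟩)
    have h2 := Metric.infDist_le_dist_of_mem (x := contraction m q) h1
    rw [dist_contraction, ← hqb] at h2
    have h3 : Metric.infDist q B ≤ Metric.infDist (contraction m q) B := hmax hq
    linarith
  intro x hx
  rw [hB3.isClosed.mem_iff_infDist_zero hB2]
  exact le_antisymm ((hmax hx).trans h0) Metric.infDist_nonneg

/-- The sets `σ^k(U₀)`. -/
def stage : ℕ → Set Plane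
  | 0 => unitSquare
  | k + 1 => hutchinson (stage k)

theorem stage_succ_subset (k : ℕ) : stage (k + 1) ⊆ stage k := by
  induction k with
  | zero =>
    intro p hp
    obtain ⟨m, q, hq, rfl⟩ := mem_hutchinson.1 hp
    exact contraction_mem m hq
  | succ k ih => exact hutchinson_mono ih

theorem boundary_subset_stage (k : ℕ) : boundary ⊆ stage k := by
  induction k with
  | zero => exact fun p hp => hp.1
  | succ k ih =>
    intro p hp
    exact mem_hutchinson.2 ⟨cellOf ⟨p, hp⟩, localPoint ⟨p, hp⟩, ih (localPoint ⟨p, hp⟩).2,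
      contraction_localPoint ⟨p, hp⟩⟩

theorem continuous_contraction (m : Cell) : Continuous (contraction m) :=
  continuous_const.add (continuous_id.const_smul (1 / 3 : ℝ))

theorem isCompact_stage (k : ℕ) : IsCompact (stage k) := by
  induction k with
  | zero => exact isCompact_unitSquare
  | succ k ih =>
    exact (Set.toFinite M).isCompact_biUnion fun m _ => ih.image (continuous_contraction m)

theorem isCarpet_iInter_stage : IsCarpet (⋂ k, stage k) := by
  refine ⟨Set.iInter_subset stage 0, ?_, ?_, ?_⟩
  · exact ⟨_, Set.mem_iInter.2 fun k => boundary_subset_stage k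
      (corner_mem (Or.inl rfl) (Or.inl rfl))⟩
  · exact (isCompact_stage 0).of_isClosed_subset
      (isClosed_iInter fun k => (isCompact_stage k).isClosed) (Set.iInter_subset stage 0)
  · refine Set.Subset.antisymm ?_ ?_
    · refine Set.subset_iInter fun k => ?_
      exact (hutchinson_mono (Set.iInter_subset stage k)).trans (stage_succ_subset k)
    · intro p hp
      have hp' : ∀ k, ∃ m : M, p ∈ contraction m '' stage k := fun k =>
        mem_hutchinson.1 (Set.mem_iInter.1 hp (k + 1))
      choose f hf using hp'
      obtain ⟨m, hm⟩ := Finite.exists_infinite_fiber f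
      have hinf : (f ⁻¹' {m}).Infinite := Set.infinite_coe_iff.1 hm
      obtain ⟨k₀, hk₀⟩ := hinf.nonempty
      obtain ⟨q, hq, hqp⟩ := hf k₀
      rw [hk₀] at hqp
      refine mem_hutchinson.2 ⟨m, q, Set.mem_iInter.2 fun k => ?_, hqp⟩
      obtain ⟨l, hl, hkl⟩ := hinf.exists_gt k
      obtain ⟨q', hq', hqp'⟩ := hf l
      rw [hl] at hqp'
      have : q' = q := contraction_injective m (hqp'.trans hqp.symm)
      exact antitone_nat_of_succ_le stage_succ_subset hkl.le (this ▸ hq')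

theorem existsUnique_isCarpet : ∃! A : Set Plane, IsCarpet A :=
  ⟨_, isCarpet_iInter_stage, fun _ hA =>
    Set.Subset.antisymm (hA.subset isCarpet_iInter_stage) (isCarpet_iInter_stage.subset hA)⟩

/-- The Sierpinski carpet: the unique non-empty compact subset of the unit square which is fixed
by `σ`. -/
def carpetSet : Set Plane := existsUnique_isCarpet.choose

theorem isCarpet_carpetSet : IsCarpet carpetSet := existsUnique_isCarpet.choose_spec.1

theorem boundary_subset_carpetSet : boundary ⊆ carpetSet := by
  rw [existsUnique_isCarpet.unique isCarpet_carpetSet isCarpet_iInter_stage]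
  exact Set.subset_iInter boundary_subset_stage

theorem contraction_mem_carpetSet (m : M) {p : Plane} (hp : p ∈ carpetSet) :
    contraction m p ∈ carpetSet := by
  rw [← isCarpet_carpetSet.2.2.2]
  exact mem_hutchinson.2 ⟨m, p, hp, rfl⟩

theorem dist_le_two_of_mem {p q : Plane} (hp : p ∈ unitSquare) (hq : q ∈ unitSquare) :
    dist p q ≤ 2 := by
  obtain ⟨p1, p2, p3, p4⟩ := hp
  obtain ⟨q1, q2, q3, q4⟩ := hq
  rw [dist_plane]
  have h1 : |p.fst - q.fst| ≤ 1 := abs_le.2 ⟨by linarith, by linarith⟩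
  have h2 : |p.snd - q.snd| ≤ 1 := abs_le.2 ⟨by linarith, by linarith⟩
  linarith

/-- The inclusion of the boundary into a larger set. -/
def subS (A : Set Plane) (h : boundary ⊆ A) (p : boundary) : ULift.{u} A :=
  ULift.up (Set.inclusion h p)

/-- A subset of the unit square which contains the boundary, with the taxicab metric and the inclusion
of the boundary, as a square metric space (in an arbitrary universe). -/
noncomputable def subSquare (A : Set Plane) (h1 : boundary ⊆ A) (h2 : A ⊆ unitSquare) : SquaMS.{u} where
  carrier := ULift.{u} A
  S := subS A h1
  S_injective _ _ h := Set.inclusion_injective h1 (ULift.up_injective h)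
  dist_le_two x y := dist_le_two_of_mem (h2 x.down.2) (h2 y.down.2)
  sq1_vertical p q h _ := by
    change dist p.1 q.1 = _
    rw [dist_plane, h, sub_self, abs_zero, zero_add, abs_sub_comm]
  sq1_horizontal p q h _ := by
    change dist p.1 q.1 = _
    rw [dist_plane, h, sub_self, abs_zero, add_zero, abs_sub_comm]
  sq2 p q := (dist_plane p.1 q.1).ge

/-- The unit square `U₀` as a square metric space. -/
noncomputable def square : SquaMS.{u} := subSquare unitSquare (fun _ hp => hp.1) subset_rfl

/-- The Sierpinski carpet `𝕊` as a square metric space. -/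
noncomputable def carpet : SquaMS.{u} :=
  subSquare carpetSet boundary_subset_carpetSet isCarpet_carpetSet.1

/-- The map `α_N : N ⊗ U₀ → U₀`, `n ⊗ z ↦ shrink n + z / 3`. -/
noncomputable def alphaN : Tensor N square.{u} → square.{u} :=
  Quot.lift (fun a => ⟨⟨contraction a.1 a.2.down.1, contraction_mem a.1 a.2.down.2⟩⟩) (by
    rintro ⟨m, _⟩ ⟨n, _⟩ ⟨p, q, rfl, rfl, h⟩
    exact congrArg ULift.up (Subtype.ext (contraction_eq_of_glued h)))

/-- The map `M ⊗ 𝕊 → N ⊗ U₀`, `m ⊗ s ↦ m ⊗ s`, induced by the inclusions `M ⊆ N` and `𝕊 ⊆ U₀`. -/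
def inclusion : Tensor M carpet.{u} → Tensor N square.{u} :=
  Quot.map (fun a => (⟨a.1.1, trivial⟩, ⟨⟨a.2.down.1, isCarpet_carpetSet.1 a.2.down.2⟩⟩)) (by
    rintro ⟨m, _⟩ ⟨n, _⟩ ⟨p, q, rfl, rfl, h⟩
    exact ⟨p, q, rfl, rfl, h⟩)

theorem alphaN_inclusion_mem (s : Tensor M carpet.{u}) :
    (alphaN (inclusion s)).down.1 ∈ carpetSet := by
  induction s using Quot.ind with
  | mk a => exact contraction_mem_carpetSet a.1 a.2.down.2

/-- The map `τ : M ⊗ 𝕊 → 𝕊`, the restriction of `α_N`. -/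
noncomputable def tauFun (s : Tensor M carpet.{u}) : carpet.{u} :=
  ⟨⟨(alphaN (inclusion s)).down.1, alphaN_inclusion_mem s⟩⟩

theorem tauFun_mk (m : M) (s : carpet.{u}) :
    (tauFun (Tensor.mk (m, s))).down.1 = shrink m + (1 / 3 : ℝ) • s.down.1 := rfl

/-- The morphism `τ : M ⊗ 𝕊 ⟶ 𝕊` of square metric spaces. -/
noncomputable def tau : tensorM.obj carpet.{u} ⟶ carpet.{u} where
  toFun := tauFun
  short s t := by
    induction s using Quot.ind with
    | mk a => induction t using Quot.ind with
      | mk b =>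
        refine dist_le_pathDist (fun a => tauFun (Tensor.mk a)) ?_ a b
        intro a b
        by_cases h : Tensor.mk a = Tensor.mk b
        · rw [h, dist_self]; exact stepScore_nonneg a b
        · obtain ⟨m, x⟩ := a
          obtain ⟨n, y⟩ := b
          simp only [stepScore, h, if_false]
          split_ifs with h'
          · subst h'
            exact (dist_contraction m x.down.1 y.down.1).le
          · exact carpet.dist_le_two _ _
  map_S p := congrArg ULift.up (Subtype.ext (contraction_localPoint p))

end carpet

end Sierpinski

namespace Sierpinski

open CategoryTheory Filter Topology

/-! ### Short maps to the square -/

/-! Corecursiveness is a Banach fixed point argument carried out in the plane rather than in the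
carpet. Choosing a representative `r b` of each `β b` turns the equation for `β*` into `f =
solveStep r f` for maps `f` from `B` to the square (`tau_equation_iff`). Each `contraction m`
shrinks distances by `1/3`, so `k` applications of the operator bring any two such maps within `2 /
3 ^ k` of each other. This gives uniqueness, and convergence of the iterates of any starting map.

The limit is a morphism if the starting map is short and preserves the boundary, because both
properties survive the operator and pointwise limits. A starting map exists since the taxicab plane
is injective: in the coordinates `x + y` and `x - y` its metric is a maximum of two absolute values,
so real Lipschitz extensions suffice (`exists_short_map_unitSquare`). Nothing about the carpet
enters up to here. The solution lands in the carpet because its range is contained in its own image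
under `hutchinson` (`subset_carpetSet`).

Surjectivity of `τ` is the fixed point equation of the carpet. For injectivity, two different cells
meet only along their sides, where points at the same position are already identified. The inverse
is not short because a path in `M ⊗ 𝕊` changes cells cheaply only through glued sides and so has to
walk around the central hole, whereas the taxicab metric of `𝕊` measures straight across it. The
function `detour` detects this: on opposite midpoints of the hole it differs by `2/3`, while their
taxicab distance is `1/3`. -/

theorem abs_clamp_sub_clamp_le (s t : ℝ) :
    |max 0 (min 1 s) - max 0 (min 1 t)| ≤ |s - t| := by
  refine (abs_max_sub_max_le_max _ _ _ _).trans (max_le (by simp) ?_)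
  exact (abs_min_sub_min_le_max _ _ _ _).trans (max_le (by simp) le_rfl)

/-- Every square metric space has a short map to the unit square which preserves the boundary. -/
theorem exists_short_map_unitSquare (X : SquaMS.{u}) :
    ∃ f : X → Plane, (∀ x y, dist (f x) (f y) ≤ dist x y) ∧ (∀ p, f (X.S p) = p.1) ∧
      ∀ x, f x ∈ unitSquare := by
  obtain ⟨v, hv, hvS, -⟩ := exists_short_extension X 1 0 (Or.inl ⟨rfl, rfl⟩)
  obtain ⟨w, hw, hwS, -⟩ := exists_short_extension X (-1) (-1) (Or.inr ⟨rfl, rfl⟩)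
  -- `v` extends the sum and `w` the difference of the coordinates, so half their sum and half their
  -- difference recover the coordinates on the boundary. The ranges of `v` and `w` only confine
  -- these to `[-1/2, 3/2]`, hence the clamping to `[0, 1]`.
  refine ⟨fun x => WithLp.toLp 1 (max 0 (min 1 ((v x + w x) / 2)),
    max 0 (min 1 ((v x - w x) / 2))), fun x y => ?_, fun p => ?_, fun x => ?_⟩
  · rw [dist_plane]
    refine (add_le_add (abs_clamp_sub_clamp_le _ _) (abs_clamp_sub_clamp_le _ _)).trans ?_
    have h1 := abs_le.1 (hv x y)
    have h2 := abs_le.1 (hw x y)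
    -- For every choice of signs the sum collapses to plus or minus the increment of `v` alone or of
    -- `w` alone.
    rcases abs_cases ((v x + w x) / 2 - (v y + w y) / 2) with ⟨h, -⟩ | ⟨h, -⟩ <;>
    rcases abs_cases ((v x - w x) / 2 - (v y - w y) / 2) with ⟨h', -⟩ | ⟨h', -⟩ <;>
    rw [h, h'] <;> linarith [h1.1, h1.2, h2.1, h2.2]
  · obtain ⟨h1, h2, h3, h4⟩ := p.2.1
    refine plane_ext ?_ ?_
    · change max 0 (min 1 ((v (X.S p) + w (X.S p)) / 2)) = _
      rw [hvS, hwS, show (p.1.fst + 1 * p.1.snd + (p.1.fst + -1 * p.1.snd)) / 2 = p.1.fst by ring,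
        min_eq_right h2, max_eq_right h1]
    · change max 0 (min 1 ((v (X.S p) - w (X.S p)) / 2)) = _
      rw [hvS, hwS, show (p.1.fst + 1 * p.1.snd - (p.1.fst + -1 * p.1.snd)) / 2 = p.1.snd by ring,
        min_eq_right h4, max_eq_right h3]
  · exact ⟨le_max_left _ _, max_le zero_le_one (min_le_left _ _), le_max_left _ _,
      max_le zero_le_one (min_le_left _ _)⟩

/-- A map to the plane which preserves the boundary induces a map on `P ⊗ X`. -/
theorem contraction_congr {P : Set Cell} {X : SquaMS.{u}} {f : X → Plane}
    (hf : ∀ p, f (X.S p) = p.1) {a b : P × X} (h : Tensor.mk a = Tensor.mk b) :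
    contraction a.1 (f a.2) = contraction b.1 (f b.2) := by
  refine congrArg (Quot.lift (fun a : P × X => contraction a.1 (f a.2)) ?_) h
  rintro ⟨m, _⟩ ⟨n, _⟩ ⟨p, q, rfl, rfl, h⟩
  simpa only [hf] using contraction_eq_of_glued h

/-- The map `m ⊗ x ↦ σ_m (f x)` is short if `f` is. -/
theorem dist_contraction_le_pathDist {P : Set Cell} {X : SquaMS.{u}} {f : X → Plane}
    (hS : ∀ p, f (X.S p) = p.1) (hf : ∀ x y, dist (f x) (f y) ≤ dist x y)
    (hU : ∀ x, f x ∈ unitSquare) (a b : P × X) :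
    dist (contraction a.1 (f a.2)) (contraction b.1 (f b.2)) ≤ pathDist a b := by
  refine dist_le_pathDist (fun a : P × X => contraction a.1 (f a.2)) (fun a b => ?_) a b
  unfold stepScore
  split_ifs with h h'
  · exact dist_le_zero.2 (contraction_congr hS h)
  · rw [h', dist_contraction]
    exact mul_le_mul_of_nonneg_left (hf _ _) (by norm_num)
  · exact dist_le_two_of_mem (contraction_mem _ (hU _)) (contraction_mem _ (hU _))

/-! ### The carpet as the largest subset of the square contained in its image under `σ` -/

theorem carpetSet_eq_iInter_stage : carpetSet = ⋂ k, stage k :=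
  existsUnique_isCarpet.unique isCarpet_carpetSet isCarpet_iInter_stage

/-- A subset of the unit square which is contained in its image under `σ` lies in the carpet. -/
theorem subset_carpetSet {A : Set Plane} (hU : A ⊆ unitSquare) (hA : A ⊆ hutchinson A) :
    A ⊆ carpetSet := by
  rw [carpetSet_eq_iInter_stage]
  refine Set.subset_iInter fun k => ?_
  induction k with
  | zero => exact hU
  | succ k ih => exact hA.trans (hutchinson_mono ih)

/-! ### Solutions of coalgebras -/

section coalgebra

variable {B : SquaMS.{u}} (r : B → M × B)

/-- The operator `f ↦ α ∘ (M ⊗ f) ∘ β` on maps to the plane, where `β b` is represented by `r b`. -/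
noncomputable def solveStep (f : B → Plane) (b : B) : Plane :=
  contraction (r b).1 (f (r b).2)

/-- The representative `r (B.S p)` need not be the standard one from `tensorS`, but both have the
same class, and for a boundary-preserving `f` the value of the operator depends only on the class.
-/
theorem solveStep_S {β : B ⟶ tensorM.obj B} (hr : ∀ b, Tensor.mk (r b) = β.toFun b)
    {f : B → Plane} (hS : ∀ p, f (B.S p) = p.1) (p : boundary) :
    solveStep r f (B.S p) = p.1 := by
  have h : Tensor.mk (r (B.S p)) = Tensor.mk (cellOf p, B.S (localPoint p)) :=
    (hr _).trans (β.map_S p)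
  rw [solveStep, contraction_congr hS h, hS, contraction_localPoint]

/-- The operator is the short map `β` followed by `m ⊗ x ↦ σ_m (f x)`, which inherits shortness from
`f`. -/
theorem dist_solveStep_le {β : B ⟶ tensorM.obj B} (hr : ∀ b, Tensor.mk (r b) = β.toFun b)
    {f : B → Plane} (hS : ∀ p, f (B.S p) = p.1) (hf : ∀ x y, dist (f x) (f y) ≤ dist x y)
    (hU : ∀ x, f x ∈ unitSquare) (x y : B) :
    dist (solveStep r f x) (solveStep r f y) ≤ dist x y := by
  refine (dist_contraction_le_pathDist hS hf hU (r x) (r y)).trans ?_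
  rw [← dist_mk, hr, hr]
  exact β.short x y

/-- Both maps are evaluated with the same representatives `r b`, so each application contributes one
common contraction by `1/3`. The constant `2` is the diameter of the square. Neither shortness nor
boundary values matter. -/
theorem dist_iterate_solveStep_le {f g : B → Plane} (hf : ∀ x, f x ∈ unitSquare)
    (hg : ∀ x, g x ∈ unitSquare) (k : ℕ) (b : B) :
    dist ((solveStep r)^[k] f b) ((solveStep r)^[k] g b) ≤ 2 * (1 / 3) ^ k := by
  induction k generalizing b with
  | zero => simpa using dist_le_two_of_mem (hf b) (hg b)
  | succ k ih =>
    rw [Function.iterate_succ_apply', Function.iterate_succ_apply']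
    simp only [solveStep, dist_contraction]
    rw [pow_succ]
    linarith [ih (r b).2]

theorem solveStep_fixedPoint_unique {f g : B → Plane} (hf : ∀ x, f x ∈ unitSquare)
    (hg : ∀ x, g x ∈ unitSquare) (hf' : solveStep r f = f) (hg' : solveStep r g = g) : f = g := by
  funext b
  have h : ∀ k : ℕ, dist (f b) (g b) ≤ 2 * (1 / 3) ^ k := fun k => by
    simpa only [Function.iterate_fixed hf', Function.iterate_fixed hg'] using
      dist_iterate_solveStep_le r hf hg k b
  have lim : Tendsto (fun k : ℕ => (2 : ℝ) * (1 / 3) ^ k) atTop (𝓝 (2 * 0)) :=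
    (tendsto_pow_atTop_nhds_zero_of_lt_one (by norm_num) (by norm_num)).const_mul 2
  rw [mul_zero] at lim
  exact dist_le_zero.1 (ge_of_tendsto' lim h)

/-- The equation of a coalgebra has a solution in the unit square. -/
theorem exists_solveStep_fixedPoint {β : B ⟶ tensorM.obj B}
    (hr : ∀ b, Tensor.mk (r b) = β.toFun b) :
    ∃ f : B → Plane, (∀ x y, dist (f x) (f y) ≤ dist x y) ∧ (∀ p, f (B.S p) = p.1) ∧
      (∀ x, f x ∈ unitSquare) ∧ solveStep r f = f := by
  obtain ⟨f, hf, hS, hU⟩ := exists_short_map_unitSquare B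
  have inv : ∀ k, (∀ x y, dist ((solveStep r)^[k] f x) ((solveStep r)^[k] f y) ≤ dist x y) ∧
      (∀ p, (solveStep r)^[k] f (B.S p) = p.1) ∧ ∀ x, (solveStep r)^[k] f x ∈ unitSquare := by
    intro k
    induction k with
    | zero => exact ⟨hf, hS, hU⟩
    | succ k ih =>
      rw [Function.iterate_succ_apply']
      exact ⟨dist_solveStep_le r hr ih.2.1 ih.1 ih.2.2, solveStep_S r hr ih.2.1,
        fun x => contraction_mem _ (ih.2.2 _)⟩
  have lim : ∀ b, ∃ z, Tendsto (fun k => (solveStep r)^[k] f b) atTop (𝓝 z) := fun b => by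
    refine cauchySeq_tendsto_of_complete (cauchySeq_of_le_geometric (1 / 3) 2 (by norm_num) ?_)
    intro k
    -- The next iterate is read as the `k`-th iterate of `solveStep r f`, so consecutive terms are
    -- two `k`-fold iterates of maps into the square.
    rw [Function.iterate_succ_apply]
    exact dist_iterate_solveStep_le r hU (inv 1).2.2 k b
  choose g hg using lim
  refine ⟨g, fun x y => ?_, fun p => ?_, fun x => ?_, funext fun b => ?_⟩
  · exact le_of_tendsto' ((hg x).dist (hg y)) fun k => (inv k).1 x y
  · refine tendsto_nhds_unique (hg (B.S p)) ?_
    simp only [fun k => (inv k).2.1 p]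
    exact tendsto_const_nhds
  · exact isCompact_unitSquare.isClosed.mem_of_tendsto (hg x) (Eventually.of_forall
      fun k => (inv k).2.2 x)
  -- The shifted sequence at `b` tends to `g b`. It also equals `σ_m` of the unshifted sequence at
  -- `(r b).2`, which tends to `σ_m (g (r b).2)` by continuity.
  · refine tendsto_nhds_unique ?_ ((tendsto_add_atTop_iff_nat 1).2 (hg b))
    simp only [Function.iterate_succ_apply']
    exact ((continuous_contraction _).tendsto _).comp (hg (r b).2)

end coalgebra

/-- The equation for a coalgebra-to-algebra morphism, in terms of representatives. -/
theorem tau_equation_iff {B : SquaMS.{u}} (r : B → M × B) {β : B ⟶ tensorM.obj B}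
    (hr : ∀ b, Tensor.mk (r b) = β.toFun b) (h : B ⟶ carpet.{u}) :
    h = β ≫ tensorM.map h ≫ tau ↔
      solveStep r (fun b => (h.toFun b).down.1) = fun b => (h.toFun b).down.1 := by
  have key : ∀ b, ((β ≫ tensorM.map h ≫ tau).toFun b).down.1 =
      solveStep r (fun b => (h.toFun b).down.1) b := fun b => by
    change (tauFun (tensorFun M h.toFun h.map_S (β.toFun b))).down.1 = _
    rw [← hr b]
    rfl
  constructor
  · intro e
    funext b
    rw [← key, ← e]
  · intro e
    refine SquaMS.Hom.ext (funext fun b => ULift.down_injective (Subtype.ext ?_))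
    rw [key, e]

theorem isCorecursive_carpet :
    IsCorecursive (F := tensorM.{u}) ⟨carpet.{u}, tau.{u}⟩ := by
  rintro ⟨B, β⟩
  have hr : ∀ b : B, ∃ a : M × B, Tensor.mk a = β.toFun b := fun b => Quot.exists_rep _
  choose r hr using hr
  obtain ⟨f, hf, hS, hU, hfix⟩ := exists_solveStep_fixedPoint r hr
  have hmem : ∀ b, f b ∈ carpetSet := fun b => by
    -- The fixed point equation writes each value `f b` as a contraction of another value of `f`,
    -- with a cell in `M`. The range need not be closed for this.
    refine subset_carpetSet (A := Set.range f) (Set.range_subset_iff.2 hU) ?_ ⟨b, rfl⟩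
    refine Set.range_subset_iff.2 fun b => mem_hutchinson.2 ?_
    exact ⟨(r b).1, _, ⟨(r b).2, rfl⟩, congrFun hfix b⟩
  refine ⟨⟨fun b => ⟨⟨f b, hmem b⟩⟩, hf,
    fun p => congrArg ULift.up (Subtype.ext (hS p))⟩, (tau_equation_iff r hr _).2 hfix, ?_⟩
  intro h e
  have e' := solveStep_fixedPoint_unique r (fun b => isCarpet_carpetSet.1 (h.toFun b).down.2) hU
    ((tau_equation_iff r hr h).1 e) hfix
  exact SquaMS.Hom.ext (funext fun b => ULift.down_injective (Subtype.ext (congrFun e' b)))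

/-! ### The inverse of `τ` -/

/-- If the columns or rows of the two cells differ, they differ by at least `1`, and a coordinate in
`[0, 1]` can make up for that only at an end of the interval. -/
theorem fst_eq_or_of_contraction_eq {m n : Cell} {p q : Plane} (hp : p ∈ unitSquare)
    (hq : q ∈ unitSquare) (h : contraction m p = contraction n q) (hmn : m ≠ n) :
    p.fst = 0 ∨ p.fst = 1 ∨ p.snd = 0 ∨ p.snd = 1 := by
  have h1 := congrArg WithLp.fst h
  have h2 := congrArg WithLp.snd h
  simp only [contraction_fst, contraction_snd] at h1 h2
  obtain ⟨p1, p2, p3, p4⟩ := hp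
  obtain ⟨q1, q2, q3, q4⟩ := hq
  have succ_le : ∀ {i j : Fin 3}, i < j → (i.val : ℝ) + 1 ≤ j.val := fun hij => by
    exact_mod_cast hij
  rcases lt_trichotomy m.1 n.1 with c | c | c
  · have := succ_le c
    exact Or.inr (Or.inl (by linarith))
  · rcases lt_trichotomy m.2 n.2 with d | d | d
    · have := succ_le d
      exact Or.inr (Or.inr (Or.inr (by linarith)))
    · exact absurd (Prod.ext c d) hmn
    · have := succ_le d
      exact Or.inr (Or.inr (Or.inl (by linarith)))
  · have := succ_le c
    exact Or.inl (by linarith)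

theorem tauFun_injective : Function.Injective tauFun.{u} := by
  intro s t h
  induction s using Quot.ind with
  | mk a => induction t using Quot.ind with
    | mk b =>
      obtain ⟨m, x⟩ := a
      obtain ⟨n, y⟩ := b
      have h' : contraction m x.down.1 = contraction n y.down.1 :=
        congrArg (fun z : carpet.{u} => z.down.1) h
      have hx := isCarpet_carpetSet.1 x.down.2
      have hy := isCarpet_carpetSet.1 y.down.2
      by_cases hmn : m = n
      · subst hmn
        rw [show x = y from ULift.down_injective (Subtype.ext (contraction_injective _ h'))]
      · have hne : m.1 ≠ n.1 := fun e => hmn (Subtype.ext e)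
        exact mk_eq_of_contraction_eq (X := carpet.{u}) m n
          ⟨_, hx, fst_eq_or_of_contraction_eq hx hy h' hne⟩
          ⟨_, hy, fst_eq_or_of_contraction_eq hy hx h'.symm hne.symm⟩ h'

theorem tauFun_surjective : Function.Surjective tauFun.{u} := by
  rintro ⟨⟨p, hp⟩⟩
  have hp' := hp
  rw [← isCarpet_carpetSet.2.2.2, mem_hutchinson] at hp'
  obtain ⟨m, q, hq, rfl⟩ := hp'
  exact ⟨Tensor.mk (m, ⟨⟨q, hq⟩⟩), rfl⟩

/-! ### Failure of shortness for `τ⁻¹`: the detour around the central hole -/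

/-- The first coordinate on `M ⊗ 𝕊`, corrected on the two cells beside the central hole such that
it measures the length of a detour around the hole. -/
noncomputable def detour (a : M × carpet.{u}) : ℝ :=
  (a.1.1.1.val + a.2.down.1.fst +
    (if a.1.1.2 = 1 then (a.1.1.1.val : ℝ) - 1 else 0) *
      min a.2.down.1.snd (1 - a.2.down.1.snd)) / 3

theorem abs_coefficient_le (m : Cell) :
    |if m.2 = 1 then (m.1.val : ℝ) - 1 else 0| ≤ 1 := by
  have h := cell_le_two m.1
  have h0 : (0 : ℝ) ≤ m.1.val := by positivity
  split_ifs
  · exact abs_le.2 ⟨by linarith, by linarith⟩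
  · simp

/-- The correction vanishes on top and bottom sides, so it is invisible to vertical gluing.
Horizontal gluing in the middle row would involve the missing central cell, and in the other rows
there is no correction. -/
theorem detour_eq_of_glueRel (a b : M × carpet.{u}) (h : GlueRel M carpet.{u} a b) :
    detour a = detour b := by
  obtain ⟨m, _⟩ := a
  obtain ⟨n, _⟩ := b
  obtain ⟨p, q, rfl, rfl, h⟩ := h
  have eS : ∀ p : boundary, (carpet.{u}.S p).down.1 = p.1 := fun _ => rfl
  simp only [detour, eS]
  obtain ⟨h1, h2, h3, h4, h5⟩ | ⟨h1, h2, h3, h4, h5⟩ := h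
  · dsimp only at h1 h2
    have hm : m.1.2 ≠ 1 := fun hm => by
      have a1 : m.1.1 ≠ 1 := fun e => m.2 (Prod.ext e hm)
      have a2 : n.1.1 ≠ 1 := fun e => n.2 (Prod.ext e (h2.trans hm))
      rw [Ne, Fin.ext_iff] at a1 a2
      have := n.1.1.isLt
      change ¬ _ = 1 at a1
      change ¬ _ = 1 at a2
      omega
    rw [if_neg hm, if_neg (h2 ▸ hm), h1, h3, h4]
    push_cast; ring
  · dsimp only at h1 h2
    rw [h1, h3, h4, h5]
    norm_num

/-- The correction depends on the second coordinate alone, with Lipschitz constant at most `1`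
before the division by `3`, so the taxicab metric has room for it beside the first coordinate. -/
theorem abs_detour_sub_le (m : M) (x y : carpet.{u}) :
    |detour (m, x) - detour (m, y)| ≤ 1 / 3 * dist x y := by
  have hd : dist x y = |x.down.1.fst - y.down.1.fst| + |x.down.1.snd - y.down.1.snd| :=
    dist_plane _ _
  have hc := abs_coefficient_le m.1
  have hmin : |min x.down.1.snd (1 - x.down.1.snd) - min y.down.1.snd (1 - y.down.1.snd)| ≤
      |x.down.1.snd - y.down.1.snd| := by
    refine (abs_min_sub_min_le_max _ _ _ _).trans (max_le le_rfl (le_of_eq ?_))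
    rw [abs_sub_comm]; congr 1; ring
  simp only [detour, hd]
  generalize (if m.1.2 = 1 then (m.1.1.val : ℝ) - 1 else 0) = c at hc
  calc _ = |1 / 3 * ((x.down.1.fst - y.down.1.fst) + c *
        (min x.down.1.snd (1 - x.down.1.snd) - min y.down.1.snd (1 - y.down.1.snd)))| := by
        congr 1; ring
    _ ≤ _ := by
      rw [abs_mul, abs_of_pos (by norm_num : (0 : ℝ) < 1 / 3)]
      refine mul_le_mul_of_nonneg_left ((abs_add_le _ _).trans (add_le_add le_rfl ?_))
        (by norm_num)
      rw [abs_mul]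
      exact (mul_le_of_le_one_left (abs_nonneg _) hc).trans hmin

/-- Crude bounds, taking the correction to be at most `1` before the division by `3`, are enough:
the oscillation `5/3` stays below the score `2` of a jump between copies. -/
theorem detour_bounds (a : M × carpet.{u}) : -1 / 3 ≤ detour a ∧ detour a ≤ 4 / 3 := by
  obtain ⟨h1, h2, h3, h4⟩ := isCarpet_carpetSet.1 a.2.down.2
  have hm := cell_le_two a.1.1.1
  have hm0 : (0 : ℝ) ≤ a.1.1.1.val := by positivity
  have hmin : |min a.2.down.1.snd (1 - a.2.down.1.snd)| ≤ 1 :=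
    abs_le.2 ⟨by linarith [le_min h3 (sub_nonneg.2 h4)], (min_le_left _ _).trans h4⟩
  have := abs_le.1 ((abs_mul _ _).trans_le
    (mul_le_one₀ (abs_coefficient_le a.1.1) (abs_nonneg _) hmin))
  unfold detour
  constructor <;> linarith [this.1, this.2]

theorem abs_detour_sub_le_pathDist (a b : M × carpet.{u}) :
    |detour a - detour b| ≤ pathDist a b := by
  refine abs_sub_le_pathDist detour detour_eq_of_glueRel abs_detour_sub_le (fun a b => ?_) a b
  obtain ⟨a1, a2⟩ := detour_bounds a
  obtain ⟨b1, b2⟩ := detour_bounds b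
  exact abs_le.2 ⟨by linarith, by linarith⟩

/-- The midpoints of the left and the right side of the central hole are closer in `𝕊` than in
`M ⊗ 𝕊`. -/
theorem exists_dist_tauFun_lt :
    ∃ s t : Tensor M carpet.{u}, dist (tauFun s) (tauFun t) < dist s t := by
  have hp : ∀ {a : ℝ}, a = 0 ∨ a = 1 → (WithLp.toLp 1 (a, 1 / 2) : Plane) ∈ boundary :=
    fun ha => vertical_mem ha (by norm_num) (by norm_num)
  have h01 : ((0, 1) : Cell) ∈ M := by simp [M]
  have h21 : ((2, 1) : Cell) ∈ M := by simp [M]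
  refine ⟨Tensor.mk (⟨(0, 1), h01⟩, carpet.S ⟨_, hp (Or.inr rfl)⟩),
    Tensor.mk (⟨(2, 1), h21⟩, carpet.S ⟨_, hp (Or.inl rfl)⟩),
    lt_of_lt_of_le ?_ (abs_detour_sub_le_pathDist _ _)⟩
  have e : ∀ (m : M) (p : boundary), (tauFun (Tensor.mk (m, carpet.S p))).down.1 =
    contraction m p := fun _ _ => rfl
  have eS : ∀ p : boundary, (carpet.{u}.S p).down.1 = p.1 := fun _ => rfl
  change dist (tauFun _).down.1 (tauFun _).down.1 < _
  rw [e, e, dist_plane]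
  simp only [contraction_fst, contraction_snd, detour, eS]
  -- The two points are `(1/3, 1/2)` and `(2/3, 1/2)`, at distance `1/3`; `detour` takes the values
  -- `1/6` and `5/6` there.
  norm_num [abs_of_neg, abs_of_pos]

end Sierpinski

theorem mainTheorem6 :
    Sierpinski.IsCorecursive (F := Sierpinski.tensorM.{u})
      ⟨Sierpinski.carpet.{u}, Sierpinski.tau.{u}⟩ ∧
    ∃ g : Sierpinski.carpet.{u} → Sierpinski.tensorM.obj Sierpinski.carpet.{u},
      Function.LeftInverse g Sierpinski.tau.toFun ∧
      Function.RightInverse g Sierpinski.tau.toFun ∧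
      ¬ ∀ x y : Sierpinski.carpet.{u}, dist (g x) (g y) ≤ dist x y := by
  refine ⟨Sierpinski.isCorecursive_carpet, ?_⟩
  obtain ⟨g, hl, hr⟩ := Function.bijective_iff_has_inverse.1
    (⟨Sierpinski.tauFun_injective.{u}, Sierpinski.tauFun_surjective.{u}⟩ :
      Function.Bijective Sierpinski.tauFun.{u})
  refine ⟨g, hl, hr, fun hshort => ?_⟩
  obtain ⟨s, t, hst⟩ := Sierpinski.exists_dist_tauFun_lt.{u}
  have h := hshort (Sierpinski.tauFun s) (Sierpinski.tauFun t)
  rw [hl s, hl t] at h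
  exact absurd h (not_le.2 hst)
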